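/- Let $a\ge 2$ be an integer and let $\alpha\in\mathbb{C}\setminus\mathbb{R}$ be a non-real root of $x^3-ax^2+x-1$. Let $<_{lex}$ be the lexicographic order on words of equal length. Let $E(R)$ be the set of sequences $\varepsilon=(\varepsilon_i)_{i\in\mathbb{Z}}$ with values in $\{0,1,\dots,a-1\}$ for which there is $k\in\mathbb{Z}$ with $\varepsilon_k>0$, $\varepsilon_i=0$ for all $i<k$, and $\varepsilon_i\varepsilon_{i-1}\varepsilon_{i-2}\varepsilon_{i-3}<_{lex}(a-1)(a-1)01$ for all $i\ge k$. Let $E(G)$ be the set of those $\varepsilon\in E(R)$ for which, with this $k$, moreover $\varepsilon_k<a$, $\varepsilon_{k+1}\varepsilon_k<_{lex}(a-1)(a-1)$ and $\varepsilon_{k+2}\varepsilon_{k+1}\varepsilon_k<_{lex}(a-1)(a-1)0$. We write $\varepsilon=(\varepsilon_i)_{i\ge l}$ if $\varepsilon_i=0$ for all $i<l$. For $\varepsilon=(\varepsilon_i)_{i\ge l}$ and $\varepsilon'=(\varepsilon'_i)_{i\ge l}$ put $$A_k(\varepsilon,\varepsilon')=\alpha^{-k+2}\sum_{i=l}^{k}(\varepsilon_i-\varepsilon'_i)\alpha^i\quad(k\ge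 l),\qquad S(\varepsilon,\varepsilon')=\{A_k(\varepsilon,\varepsilon') : k\ge l\}.$$ Put $$S_a=\{0,\ \pm\alpha,\ \pm\alpha^2,\ \pm(\alpha-\alpha^2),\ \pm(1+(a-1)\alpha^2),\ \pm(1+(a-2)\alpha^2),\ \pm(1-\alpha+(a-1)\alpha^2),\ \pm(1-2\alpha+a\alpha^2)\}.$$ Let $\mathcal{A}$ be the automaton with set of states $S_a$, initial state $0$, and as edges all $(s,(e,f),t)\in S_a\times\{0,\dots,a-1\}^2\times S_a$ with $t=\frac{s}{\alpha}+(e-f)\alpha^2$. It recognizes an infinite word if the word labels an infinite path in $\mathcal{A}$ starting at $0$. **Theorem 4.2.** The set $S_a$ has exactly 15 elements, and $\mathcal{A}$ is finite. Let $X=E(R)$ (resp. $X=E(G)$). For every $\varepsilon\in X$ the series $\sum_{i}\varepsilon_i\alpha^i$ converges absolutely. Let $l\in\mathbb{Z}$, let $\varepsilon=(\varepsilon_i)_{i\ge l}$ and $\varepsilon'=(\varepsilon'_i)_{i\ge l}$ be in $X$, and let $x=\sum_{i=l}^\infty\varepsilon_i\alpha^i$, $y=\sum_{i=l}^\infty\varepsilon'_i\alpha^i$.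 Then: 1. $x=y$ if and only if $S(\varepsilon,\varepsilon')$ is finite. 2. If $x=y$, then $S(\varepsilon,\varepsilon')\subset S_a$. 3. $x=y$ if and only if $\mathcal{A}$ recognizes the infinite word $(\varepsilon_l,\varepsilon'_l)(\varepsilon_{l+1},\varepsilon'_{l+1})\cdots$. Moreover, $$S_a=\bigcup_{(\varepsilon,\varepsilon')\in\Delta}S(\varepsilon,\varepsilon'),$$ where $\Delta$ is the set of all pairs $((\varepsilon_i)_{i\ge l},(\varepsilon'_i)_{i\ge l})\in X\times X$, $l\in\mathbb{Z}$, with $\sum_{i=l}^\infty\varepsilon_i\alpha^i=\sum_{i=l}^\infty\varepsilon'_i\alpha^i$. Consequently, a point $z\in\mathbb{C}$ has at least two expansions $z=\sum_i\varepsilon_i\alpha^i$ with $\varepsilon\in X$ if and only if there are $l\in\mathbb{Z}$ and distinct $\varepsilon=(\varepsilon_i)_{i\ge l}$, $\varepsilon'=(\varepsilon'_i)_{i\ge l}$ in $X$ such that $z=\sum_{i=l}^\infty\varepsilon_i\alpha^i$ and $\mathcal{A}$ recognizes $(\varepsilon_l,\varepsilon'_l)(\varepsilon_{l+1},\varepsilon'_{l+1})\cdots$.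 -/

import Mathlib

namespace CubicRauzy

/-- `E(R)`: the two-sided digit sequences over `{0, …, a-1}` that have a first nonzero digit `ε k`
(so they vanish below `k`) and satisfy `ε_i ε_{i-1} ε_{i-2} ε_{i-3} <_lex (a-1)(a-1)01` for all
`i ≥ k`. The order `<` on lists of natural numbers is the lexicographic order. -/
def ER (a : ℕ) : Set (ℤ → ℕ) :=
  {ε | (∀ i, ε i < a) ∧
    ∃ k : ℤ, 0 < ε k ∧ (∀ i < k, ε i = 0) ∧
      ∀ i ≥ k, [ε i, ε (i - 1), ε (i - 2), ε (i - 3)] < [a - 1, a - 1, 0, 1]}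

/-- `E(G)`: the same conditions as for `E(R)`, together with the initial conditions at the first
nonzero digit `ε k`. -/
def EG (a : ℕ) : Set (ℤ → ℕ) :=
  {ε | (∀ i, ε i < a) ∧
    ∃ k : ℤ, 0 < ε k ∧ (∀ i < k, ε i = 0) ∧
      (∀ i ≥ k, [ε i, ε (i - 1), ε (i - 2), ε (i - 3)] < [a - 1, a - 1, 0, 1]) ∧
      ε k < a ∧
      [ε (k + 1), ε k] < [a - 1, a - 1] ∧
      [ε (k + 2), ε (k + 1), ε k] < [a - 1, a - 1, 0]}

/-- The sequence `ε` is of the form `(ε_i)_{i ≥ l}`: it vanishes below `l`. -/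
def StartsAt (l : ℤ) (ε : ℤ → ℕ) : Prop := ∀ i < l, ε i = 0

/-- The `α`-sum `∑ ε_i α^i` over all integers `i`; for a sequence `(ε_i)_{i ≥ l}` the terms
with `i < l` are zero. -/
noncomputable def alphaSum (α : ℂ) (ε : ℤ → ℕ) : ℂ := ∑' i : ℤ, (ε i : ℂ) * α ^ i

/-- The normalized partial difference
`A_k(ε, ε') = α^(-k+2) ∑_{i=l}^{k} (ε_i - ε'_i) α^i`. -/
noncomputable def partialDiff (α : ℂ) (l : ℤ) (ε ε' : ℤ → ℕ) (k : ℤ) : ℂ :=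
  α ^ (-k + 2) * ∑ i ∈ Finset.Icc l k, ((ε i : ℂ) - (ε' i : ℂ)) * α ^ i

/-- `S(ε, ε') = {A_k(ε, ε') ; k ≥ l}`. -/
def diffSet (α : ℂ) (l : ℤ) (ε ε' : ℤ → ℕ) : Set ℂ :=
  {z | ∃ k ≥ l, z = partialDiff α l ε ε' k}

/-- The explicit set `S_a`. -/
def stateSet (a : ℕ) (α : ℂ) : Set ℂ :=
  {z | z = 0 ∨
    ∃ w ∈ ({α, α ^ 2, α - α ^ 2, 1 + ((a : ℂ) - 1) * α ^ 2, 1 + ((a : ℂ) - 2) * α ^ 2,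
        1 - α + ((a : ℂ) - 1) * α ^ 2, 1 - 2 * α + (a : ℂ) * α ^ 2} : Set ℂ),
      z = w ∨ z = -w}

/-- `Δ`: the pairs `((ε_i)_{i ≥ l}, (ε'_i)_{i ≥ l})` in `X × X` with equal `α`-sums, recorded
together with their common starting index `l`. -/
def Delta (X : Set (ℤ → ℕ)) (α : ℂ) : Set (ℤ × (ℤ → ℕ) × (ℤ → ℕ)) :=
  {d | d.2.1 ∈ X ∧ d.2.2 ∈ X ∧ StartsAt d.1 d.2.1 ∧ StartsAt d.1 d.2.2 ∧
    alphaSum α d.2.1 = alphaSum α d.2.2}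

/-- An automaton reading infinite words over `L`: a set of states, a set of labelled edges
(source, label, target), and a set of initial states. -/
structure WordAutomaton (Q L : Type) where
  states : Set Q
  edges : Set (Q × L × Q)
  initial : Set Q

/-- `M` recognizes the infinite word `w` if `w` labels an infinite path of `M` that starts in an
initial state. -/
def WordAutomaton.Recognizes {Q L : Type} (M : WordAutomaton Q L) (w : ℕ → L) : Prop :=
  ∃ q : ℕ → Q, q 0 ∈ M.initial ∧ (∀ n, q n ∈ M.states) ∧ ∀ n, (q n, w n, q (n + 1)) ∈ M.edges

/-- The automaton `𝒜`: its states are the elements of `S_a`, its edges are the triples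
`(s, (e, f), t)` with digits `e, f ∈ {0, …, a-1}` and `t = s / α + (e - f) α²`, and `0` is its
initial state. -/
def automaton (a : ℕ) (α : ℂ) : WordAutomaton ℂ (ℕ × ℕ) where
  states := stateSet a α
  edges := {x | ∃ s ∈ stateSet a α, ∃ t ∈ stateSet a α, ∃ e < a, ∃ f < a,
    t = s / α + ((e : ℂ) - (f : ℂ)) * α ^ 2 ∧ x = (s, (e, f), t)}
  initial := {0}

/-- The infinite word `(ε_l, ε'_l)(ε_{l+1}, ε'_{l+1})⋯`. -/
def pairWord (l : ℤ) (ε ε' : ℤ → ℕ) : ℕ → ℕ × ℕ :=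
  fun n => (ε (l + n), ε' (l + n))

end CubicRauzy

/-! Write the digit differences `δ` as a convolution of an integer sequence `C` with the
coefficients of the cubic. Each `A_k` is then the value at `α` of a window of three consecutive
terms of `C` (`IsQuotient.scaledSum_eq`), and the same windows give the corresponding sums at the
real conjugate `β` of `α`. At `β`, admissibility is a greedy condition and bounds these values by `β
^ 3` (`IsAdmissible.lt_of_rec`). At `α`, where `‖α‖ < 1`, equality of the two sums turns a partial
sum into minus a geometric tail, so the `A_k` are bounded (`norm_partialDiff_le`). Bounds at both
places make `C` bounded (`exists_coeff_bound`). An extremal argument with the value at `β` then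
forces `|C n| ≤ 1` (`IsQuotientSeq.abs_le_one`), and only 15 windows survive (`mem_windows`): these
are `S_a`. Conversely, finitely many `A_k` make the partial sums tend to 0. Two explicit eventually
periodic sequences `C`, with their negatives, realize every window by digits already in `E(G)`. -/

namespace CubicRauzy

/-! ### The real conjugate and linear independence -/

/-- The facts about the real conjugate `β` of `α` that are used throughout. -/
structure IsRealConjugate (a : ℕ) (α : ℂ) (β : ℝ) : Prop where
  root : β ^ 3 - a * β ^ 2 + β - 1 = 0
  lower : (a : ℝ) - 1 / 4 ≤ β
  upper : β < a
  trace : (a : ℝ) - β = 2 * α.re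
  norm_mul : β * Complex.normSq α = 1

theorem sq_eq_trace_norm (α : ℂ) :
    α ^ 2 = ((2 * α.re : ℝ) : ℂ) * α - ((Complex.normSq α : ℝ) : ℂ) := by
  apply Complex.ext
  · simp [pow_two, Complex.normSq_apply]; ring
  · simp [pow_two, Complex.normSq_apply]; ring

theorem real_add_real_mul_eq_zero {α : ℂ} (h : α.im ≠ 0) {x y : ℝ}
    (e : (x : ℂ) + (y : ℂ) * α = 0) : x = 0 ∧ y = 0 := by
  have h1 := congrArg Complex.im e
  have h2 := congrArg Complex.re e
  simp [h] at h1
  subst h1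
  simpa using h2

theorem exists_realConjugate {a : ℕ} (ha : 2 ≤ a) {α : ℂ}
    (hα : α ^ 3 - (a : ℂ) * α ^ 2 + α - 1 = 0) (him : α.im ≠ 0) :
    ∃ β : ℝ, IsRealConjugate a α β := by
  have hN : 0 < Complex.normSq α := Complex.normSq_pos.2 (fun h => him (by simp [h]))
  obtain ⟨τ, hτ⟩ : ∃ τ, τ = 2 * α.re := ⟨_, rfl⟩
  obtain ⟨N, hN'⟩ : ∃ N, N = Complex.normSq α := ⟨_, rfl⟩
  have hsq := sq_eq_trace_norm α
  rw [← hτ, ← hN'] at hsq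
  rw [← hN'] at hN
  have ha' : (2 : ℝ) ≤ a := by exact_mod_cast ha
  -- The remainder of the cubic modulo `x² - τx + N`, evaluated at `α`.
  have key : (((a - τ) * N - 1 : ℝ) : ℂ) + ((1 - N - (a - τ) * τ : ℝ) : ℂ) * α = 0 := by
    push_cast
    have h3 : α ^ 3 = τ * α ^ 2 - N * α := by
      calc α ^ 3 = α * α ^ 2 := by ring
        _ = _ := by rw [hsq]; ring_nf; rw [hsq]; ring
    linear_combination hα - h3 + ((a : ℂ) - τ) * hsq
  obtain ⟨e1, e2⟩ := real_add_real_mul_eq_zero him key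
  obtain ⟨β, hβ⟩ : ∃ β, β = (a : ℝ) - τ := ⟨_, rfl⟩
  have hτβ : τ = a - β := by linarith
  rw [← hβ] at e1 e2
  have root : β ^ 3 - a * β ^ 2 + β - 1 = 0 := by
    rw [hτβ] at e2
    linear_combination β * e2 + e1
  have hpos : 0 < β := by
    by_contra h
    nlinarith [mul_nonneg (by linarith : 0 ≤ -β) hN.le]
  have h1 : 1 < β := by
    by_contra h
    nlinarith [mul_pos (pow_pos hpos 2) (by linarith : 0 < (a : ℝ) - β)]
  -- The cubic gives `a - β = (β - 1) / β²`, which is positive, and at most `1/4` because `(β - 2)²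
  -- ≥ 0`.
  refine ⟨β, root, ?_, ?_, ?_, ?_⟩
  · by_contra h
    push Not at h
    have : β ^ 2 * (1 / 4) < β ^ 2 * (a - β) :=
      mul_lt_mul_of_pos_left (by linarith) (by positivity)
    nlinarith [sq_nonneg (β - 2)]
  · by_contra h
    push Not at h
    have : 0 ≤ β ^ 2 * (β - a) := mul_nonneg (by positivity) (by linarith)
    nlinarith
  · rw [← hτ]; linarith
  · rw [← hN']; linarith

namespace IsRealConjugate
variable {a : ℕ} {α : ℂ} {β : ℝ}

theorem one_lt (h : IsRealConjugate a α β) (ha : 2 ≤ a) : 1 < β := by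
  have : (2 : ℝ) ≤ a := by exact_mod_cast ha
  linarith [h.lower]

theorem norm_lt_one (h : IsRealConjugate a α β) (ha : 2 ≤ a) : ‖α‖ < 1 := by
  have h1 := h.one_lt ha
  have h2 := h.norm_mul
  rw [Complex.normSq_eq_norm_sq] at h2
  by_contra hc
  push Not at hc
  nlinarith [one_le_pow₀ (n := 2) hc]

/-- A real linear combination of `1, α, α²` in terms of the real basis `1, α` of `ℂ`. -/
theorem combination_eq (α : ℂ) (p q r : ℝ) :
    (p : ℂ) + q * α + r * α ^ 2 =
      ((p - r * Complex.normSq α : ℝ) : ℂ) + ((q + r * (2 * α.re) : ℝ) : ℂ) * α := by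
  rw [sq_eq_trace_norm]; push_cast; ring

/-- A rational algebraic integer is an integer, but `β` lies strictly between `a - 1` and `a`. -/
theorem not_rational (h : IsRealConjugate a α β) (x : ℚ) : (x : ℝ) ≠ β := by
  rintro rfl
  have hi : IsIntegral ℤ x := by
    refine ⟨Polynomial.X ^ 3 - Polynomial.C (a : ℤ) * Polynomial.X ^ 2 + Polynomial.X
      - Polynomial.C 1, ?_, ?_⟩
    · monicity!
    · have := h.root
      simp only [Polynomial.eval₂_sub, Polynomial.eval₂_add, Polynomial.eval₂_mul,
        Polynomial.eval₂_pow, Polynomial.eval₂_X, Polynomial.eval₂_C]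
      simp
      exact_mod_cast this
  obtain ⟨y, hy⟩ := IsIntegrallyClosed.isIntegral_iff.1 hi
  simp only [algebraMap_int_eq, eq_intCast] at hy
  subst hy
  have h1 := h.lower
  have h2 := h.upper
  simp only [Rat.cast_intCast] at h1 h2
  have h3 : y < (a : ℤ) := by exact_mod_cast h2
  have h4 : (a : ℤ) < y + 1 := by
    have : (a : ℝ) < y + 1 := by linarith
    exact_mod_cast this
  omega

/-- `1, α, α²` are linearly independent over `ℤ`. -/
theorem eq_zero_of_combination (h : IsRealConjugate a α β) (him : α.im ≠ 0) {p q r : ℤ}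
    (e : (p : ℂ) + q * α + r * α ^ 2 = 0) : p = 0 ∧ q = 0 ∧ r = 0 := by
  have e' := combination_eq α p q r
  push_cast at e'
  rw [e] at e'
  obtain ⟨h1, h2⟩ := real_add_real_mul_eq_zero (x := p - r * Complex.normSq α)
    (y := q + r * (2 * α.re)) him (by push_cast; exact e'.symm)
  have hr : r = 0 := by
    by_contra hr
    have hr' : (r : ℝ) ≠ 0 := by exact_mod_cast hr
    -- The vanishing `α`-coordinate reads `q + r (a - β) = 0`.
    apply h.not_rational (a + q / r)
    push_cast
    have := h.trace
    field_simp
    rw [← this] at h2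
    linarith
  subst hr
  simp only [Int.cast_zero, zero_mul, sub_zero, add_zero, Int.cast_eq_zero] at h1 h2
  exact ⟨h1, h2, rfl⟩

/-- A real combination of `1, t, t²` that is bounded at `t = α` and at `t = β` has bounded
coefficients. -/
theorem exists_coeff_bound (h : IsRealConjugate a α β) (ha : 2 ≤ a) (him : α.im ≠ 0) (K L : ℝ) :
    ∃ B : ℝ, ∀ p q r : ℝ, ‖(p : ℂ) + q * α + r * α ^ 2‖ ≤ K → |p + q * β + r * β ^ 2| ≤ L →
      |p| ≤ B ∧ |q| ≤ B ∧ |r| ≤ B := by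
  obtain ⟨τ, hτ⟩ : ∃ τ, τ = 2 * α.re := ⟨_, rfl⟩
  obtain ⟨N, hN⟩ : ∃ N, N = Complex.normSq α := ⟨_, rfl⟩
  -- This number is `|β - α|²`.
  have hD : 0 < β ^ 2 - τ * β + N := by
    have := sq_nonneg (β - α.re)
    have h3 : 0 < α.im ^ 2 := by positivity
    rw [hN, hτ, Complex.normSq_apply]
    nlinarith
  have hβ := h.one_lt ha
  set D := β ^ 2 - τ * β + N with hDdef
  refine ⟨K / |α.im| * (1 + |α.re|) + K + K / |α.im| +
    (L + (K + K / |α.im| * |α.re|) + K / |α.im| * β) / D * (|N| + |τ| + 1), ?_⟩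
  intro p q r hα hb
  have hK : 0 ≤ K := (norm_nonneg _).trans hα
  have hL : 0 ≤ L := (abs_nonneg _).trans hb
  have him' : 0 < |α.im| := abs_pos.2 him
  rw [combination_eq, ← hτ, ← hN] at hα
  -- Dividing `p + qt + rt²` by `t² - τt + N` gives quotient `r` and remainder `X + Yt`. The value
  -- at `α` controls `X` and `Y`; the value at `β` then controls `r`.
  set X := p - r * N with hX
  set Y := q + r * τ with hY
  have hYb : |Y| ≤ K / |α.im| := by
    rw [le_div_iff₀ him', ← abs_mul]
    refine le_trans ?_ ((Complex.abs_im_le_norm _).trans hα)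
    simp
  have hXb : |X| ≤ K + K / |α.im| * |α.re| := by
    have h1 := (Complex.abs_re_le_norm _).trans hα
    simp at h1
    have h2 : |Y * α.re| ≤ K / |α.im| * |α.re| := by
      rw [abs_mul]; gcongr
    have h3 : X = (X + Y * α.re) - Y * α.re := by ring
    rw [h3]
    exact (abs_sub _ _).trans (add_le_add h1 h2)
  have hrb : |r| ≤ (L + (K + K / |α.im| * |α.re|) + K / |α.im| * β) / D := by
    rw [le_div_iff₀ hD, ← abs_of_pos hD, ← abs_mul]
    have h3 : r * D = (p + q * β + r * β ^ 2) - X - Y * β := by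
      rw [hX, hY, hDdef]; ring
    rw [h3]
    refine (abs_sub _ _).trans (add_le_add ((abs_sub _ _).trans (add_le_add hb hXb)) ?_)
    rw [abs_mul, abs_of_pos (by linarith : 0 < β)]
    gcongr
  set R := (L + (K + K / |α.im| * |α.re|) + K / |α.im| * β) / D
  have hR : 0 ≤ R := (abs_nonneg _).trans hrb
  have hY0 : 0 ≤ K / |α.im| := by positivity
  have hN0 := abs_nonneg N
  have hτ0 := abs_nonneg τ
  have hre0 := abs_nonneg α.re
  have m1 : |r * N| ≤ R * |N| := by rw [abs_mul]; gcongr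
  have m2 : |r * τ| ≤ R * |τ| := by rw [abs_mul]; gcongr
  have n1 : 0 ≤ R * |N| := by positivity
  have n2 : 0 ≤ R * |τ| := by positivity
  have n3 : 0 ≤ K / |α.im| * |α.re| := by positivity
  have hp : p = X + r * N := by rw [hX]; ring
  have hq : q = Y - r * τ := by rw [hY]; ring
  refine ⟨?_, ?_, ?_⟩
  · rw [hp]
    have := abs_add_le X (r * N)
    linarith
  · rw [hq]
    have := abs_sub Y (r * τ)
    linarith
  · linarith

end IsRealConjugate
end CubicRauzy

/-! ### Bounded quotient sequences -/

namespace CubicRauzy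

/-- The integer windows `(u, v, w)` whose values `u α³ + v (α - α²) + w α²` make up `S_a`. -/
def windows : Finset (ℤ × ℤ × ℤ) :=
  {(0, 0, 0), (0, 1, 1), (0, -1, -1), (0, 0, 1), (0, 0, -1), (0, 1, 0), (0, -1, 0),
    (1, 1, 0), (-1, -1, 0), (1, 1, -1), (-1, -1, 1), (1, 0, -1), (-1, 0, 1),
    (1, -1, -1), (-1, 1, 1)}

theorem card_windows : windows.card = 15 := by decide

/-- The sequences that arise as quotients of digit differences by the cubic polynomial:
the digit differences are bounded by `a - 1`, and the value at `β` is less than `β³`. -/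
structure IsQuotientSeq (a : ℕ) (β : ℝ) (C : ℕ → ℤ) : Prop where
  digit : ∀ n, |C (n + 3) - C (n + 2) + a * C (n + 1) - C n| ≤ (a : ℤ) - 1
  value : ∀ n, |(C n : ℝ) * β ^ 2 + C (n + 1) * (1 - β) + C (n + 2) * β| < β ^ 2

namespace IsQuotientSeq
variable {a : ℕ} {β : ℝ} {C : ℕ → ℤ}

theorem neg (h : IsQuotientSeq a β C) : IsQuotientSeq a β (-C) where
  digit n := by
    rw [← abs_neg]; convert h.digit n using 2; simp only [Pi.neg_apply]; ring
  value n := by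
    rw [← abs_neg]; convert h.value n using 2; simp only [Pi.neg_apply]; push_cast; ring

/-- A bound `M` that is attained is small. -/
theorem attained_bound (h : IsQuotientSeq a β C) (hβ : 1 < β) {M : ℤ} (hM : ∀ n, |C n| ≤ M) {n : ℕ}
    (hn : C n = M) : M * (β - 1) ^ 2 < β ^ 2 := by
  have h1 := (abs_lt.1 (h.value n)).2
  rw [hn] at h1
  have h2 : (C (n + 1) : ℝ) ≤ M := by exact_mod_cast (abs_le.1 (hM (n + 1))).2
  have h3 : (-M : ℝ) ≤ C (n + 2) := by exact_mod_cast (abs_le.1 (hM (n + 2))).1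
  -- The worst case is `C (n + 1) = M`, `C (n + 2) = -M`, where the value is `M (β² - 2β + 1)`.
  nlinarith [mul_le_mul_of_nonneg_left h2 (by linarith : 0 ≤ β - 1),
    mul_le_mul_of_nonneg_left h3 (by linarith : 0 ≤ β)]

/-- Here `β ≥ 15/4`, so `2 (β - 1)² > β²`. This fails for `a = 2, 3`, which need sharper arguments.
-/
theorem ne_bound_of_four_le (h : IsQuotientSeq a β C) (ha : 4 ≤ a) (hl : (a : ℝ) - 1 / 4 ≤ β)
    {M : ℤ} (hM2 : 2 ≤ M) (hM : ∀ n, |C n| ≤ M) (n : ℕ) : C n ≠ M := by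
  intro hn
  have ha' : (4 : ℝ) ≤ a := by exact_mod_cast ha
  have h1 := h.attained_bound (by linarith) hM hn
  have hM2' : (2 : ℝ) ≤ M := by exact_mod_cast hM2
  nlinarith [mul_le_mul_of_nonneg_right hM2' (sq_nonneg (β - 1))]

/-- The value bound with `β` replaced by a rational approximation. -/
theorem approx_value (h : IsQuotientSeq a β C) {b s δ : ℝ} (h1 : |β - b| ≤ δ)
    (h2 : |β ^ 2 - s| ≤ 4 * δ) {M : ℤ} (hM : ∀ n, |C n| ≤ M) (n : ℕ) :
    |(C n : ℝ) * s + C (n + 1) * (1 - b) + C (n + 2) * b| < s + (6 * M + 4) * δ := by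
  have hv := h.value n
  have hM' : ∀ n, |(C n : ℝ)| ≤ M := fun n => by exact_mod_cast hM n
  have e1 : |(C n : ℝ) * (β ^ 2 - s)| ≤ M * (4 * δ) := by
    rw [abs_mul]; exact mul_le_mul (hM' _) h2 (abs_nonneg _) ((abs_nonneg _).trans (hM' n))
  have e2 : |(C (n + 1) : ℝ) * (β - b)| ≤ M * δ := by
    rw [abs_mul]; exact mul_le_mul (hM' _) h1 (abs_nonneg _) ((abs_nonneg _).trans (hM' n))
  have e3 : |(C (n + 2) : ℝ) * (β - b)| ≤ M * δ := by
    rw [abs_mul]; exact mul_le_mul (hM' _) h1 (abs_nonneg _) ((abs_nonneg _).trans (hM' n))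
  rw [abs_lt] at hv ⊢
  rw [abs_le] at e1 e2 e3 h2
  constructor <;> nlinarith

/-- With `β ≈ 2.769` an attained bound can only be `M = 2`, and then two consecutive value bounds
are incompatible. -/
theorem ne_bound_of_eq_three (h : IsQuotientSeq 3 β C) (hroot : β ^ 3 - 3 * β ^ 2 + β - 1 = 0)
    (hl : 11 / 4 ≤ β) (hu : β < 3) {M : ℤ} (hM2 : 2 ≤ M) (hM : ∀ n, |C n| ≤ M) (n : ℕ) :
    C n ≠ M := by
  have hu2 : β < 27695 / 10000 := by
    by_contra hc
    push Not at hc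
    nlinarith [mul_nonneg (sub_nonneg.2 hc) (sub_nonneg.2 hc), pow_two_nonneg (β - 2)]
  have hl2 : 2769 / 1000 < β := by
    by_contra hc
    push Not at hc
    nlinarith [mul_nonneg (sub_nonneg.2 hc) (sub_nonneg.2 hl), pow_two_nonneg (β - 2)]
  intro hn
  have hb := h.attained_bound (by linarith) hM hn
  have hM3 : M = 2 := by
    have : (M : ℝ) < 3 := by
      by_contra hc
      push Not at hc
      nlinarith [mul_le_mul_of_nonneg_right hc (sq_nonneg (β - 1))]
    have : M < 3 := by exact_mod_cast this
    omega
  subst hM3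
  -- The value bound times `10⁴`; the error `16 / 1000` gives `76833`, rounded up.
  have key : ∀ m, |C m * 76673 + C (m + 1) * (-17690) + C (m + 2) * 27690| < 76900 := by
    intro m
    have := h.approx_value (b := 2769 / 1000) (s := 76673 / 10000) (δ := 1 / 1000)
      (abs_le.2 ⟨by linarith, by linarith⟩) (abs_le.2 ⟨by nlinarith, by nlinarith⟩) hM m
    rw [abs_lt] at this
    push_cast at this
    rw [abs_lt]
    constructor
    · have : (-(76900) : ℝ) < C m * 76673 + C (m + 1) * (-17690) + C (m + 2) * 27690 := by
        linarith
      exact_mod_cast this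
    · have : C m * 76673 + C (m + 1) * (-17690) + C (m + 2) * 27690 < (76900 : ℝ) := by
        linarith
      exact_mod_cast this
  have k0 := abs_lt.1 (key n)
  have k1 := abs_lt.1 (key (n + 1))
  have b1 := abs_le.1 (hM (n + 1))
  have b2 := abs_le.1 (hM (n + 2))
  have b3 := abs_le.1 (hM (n + 3))
  simp only [add_assoc, Nat.reduceAdd] at k1
  rw [hn] at k0
  generalize C (n + 1) = c1 at *
  generalize C (n + 2) = c2 at *
  generalize C (n + 3) = c3 at *
  obtain ⟨l2, u2⟩ := b2
  interval_cases c2 <;> omega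

/-- With `β ≈ 1.755` attained bounds up to 5 are possible, so eight consecutive terms and the digit
bounds are also used. -/
theorem ne_bound_of_eq_two (h : IsQuotientSeq 2 β C) (hroot : β ^ 3 - 2 * β ^ 2 + β - 1 = 0)
    (hl : 7 / 4 ≤ β) (hu : β < 2) {M : ℤ} (hM2 : 2 ≤ M) (hM : ∀ n, |C n| ≤ M) (n : ℕ) :
    C n ≠ M := by
  have hu2 : β < 17550 / 10000 := by
    by_contra hc
    push Not at hc
    nlinarith [mul_nonneg (sub_nonneg.2 hc) (sub_nonneg.2 hc), pow_two_nonneg (β - 1)]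
  have hl2 : 17548 / 10000 < β := by
    by_contra hc
    push Not at hc
    nlinarith [mul_nonneg (sub_nonneg.2 hc) (sub_nonneg.2 hl), pow_two_nonneg (β - 1)]
  intro hn
  have hb := h.attained_bound (by linarith) hM hn
  have hM3 : M ≤ 5 := by
    have : (M : ℝ) < 6 := by
      by_contra hc
      push Not at hc
      nlinarith [mul_le_mul_of_nonneg_right hc (sq_nonneg (β - 1))]
    have : M < 6 := by exact_mod_cast this
    omega
  -- Again scaled by `10⁴`; for `M ≤ 5` the error is at most `34 / 10000`, giving `30830`, rounded
  -- up.
  have key : ∀ m, |C m * 30796 + C (m + 1) * (-7549) + C (m + 2) * 17549| < 30850 := by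
    intro m
    have := h.approx_value (b := 17549 / 10000) (s := 30796 / 10000) (δ := 1 / 10000)
      (abs_le.2 ⟨by linarith, by linarith⟩) (abs_le.2 ⟨by nlinarith, by nlinarith⟩) hM m
    rw [abs_lt] at this
    have hM3' : (M : ℝ) ≤ 5 := by exact_mod_cast hM3
    rw [abs_lt]
    constructor
    · have : (-30850 : ℝ) < C m * 30796 + C (m + 1) * (-7549) + C (m + 2) * 17549 := by
        linarith
      exact_mod_cast this
    · have : C m * 30796 + C (m + 1) * (-7549) + C (m + 2) * 17549 < (30850 : ℝ) := by
        linarith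
      exact_mod_cast this
  have k0 := abs_lt.1 (key n)
  have k1 := abs_lt.1 (key (n + 1))
  have k2 := abs_lt.1 (key (n + 2))
  have k3 := abs_lt.1 (key (n + 3))
  have b1 := abs_le.1 (hM (n + 1))
  have b2 := abs_le.1 (hM (n + 2))
  have b3 := abs_le.1 (hM (n + 3))
  have b4 := abs_le.1 (hM (n + 4))
  have b5 := abs_le.1 (hM (n + 5))
  have d0 := abs_le.1 (h.digit n)
  have d1 := abs_le.1 (h.digit (n + 1))
  have d2 := abs_le.1 (h.digit (n + 2))
  have k4 := abs_lt.1 (key (n + 4))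
  have b6 := abs_le.1 (hM (n + 6))
  have k5 := abs_lt.1 (key (n + 5))
  have b7 := abs_le.1 (hM (n + 7))
  have d3 := abs_le.1 (h.digit (n + 3))
  simp only [add_assoc, Nat.reduceAdd, Nat.cast_ofNat] at k1 k2 k3 k4 k5 d0 d1 d2 d3
  generalize C n = c0 at *
  generalize C (n + 1) = c1 at *
  generalize C (n + 2) = c2 at *
  generalize C (n + 3) = c3 at *
  generalize C (n + 4) = c4 at *
  generalize C (n + 5) = c5 at *
  generalize C (n + 6) = c6 at *
  generalize C (n + 7) = c7 at *
  clear hM h key hb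
  subst hn
  obtain ⟨l2, u2⟩ := b1
  interval_cases c0 <;> interval_cases c1 <;> omega

/-- Descent on the bound: while it is at least 2, neither it nor its negative (apply the case lemmas
to `-C`) is attained, so it drops by one. -/
theorem abs_le_one (h : IsQuotientSeq a β C) (ha : 2 ≤ a)
    (hroot : β ^ 3 - a * β ^ 2 + β - 1 = 0) (hl : (a : ℝ) - 1 / 4 ≤ β) (hu : β < a)
    {M : ℕ} (hM : ∀ n, |C n| ≤ M) : ∀ n, |C n| ≤ 1 := by
  have step : ∀ {C : ℕ → ℤ}, IsQuotientSeq a β C → ∀ {M : ℤ}, 2 ≤ M → (∀ n, |C n| ≤ M) →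
      ∀ n, C n ≠ M := by
    intro C h M h2 hM
    rcases Nat.lt_or_ge a 4 with h4 | h4
    · interval_cases a
      · exact h.ne_bound_of_eq_two (by exact_mod_cast hroot) (by norm_num at hl; linarith)
          (by exact_mod_cast hu) h2 hM
      · exact h.ne_bound_of_eq_three (by exact_mod_cast hroot) (by norm_num at hl; linarith)
          (by exact_mod_cast hu) h2 hM
    · exact h.ne_bound_of_four_le h4 hl h2 hM
  induction M with
  | zero => intro n; have := hM n; push_cast at this; omega
  | succ M ih =>
    rcases Nat.eq_zero_or_pos M with rfl | hpos
    · simpa using hM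
    · apply ih
      intro n
      have h1 := step h (M := ((M + 1 : ℕ) : ℤ)) (by push_cast; omega) hM n
      have h2 := step h.neg (M := ((M + 1 : ℕ) : ℤ)) (by push_cast; omega)
        (by intro n; simpa using hM n) n
      have h3 := abs_le.1 (hM n)
      simp only [Pi.neg_apply] at h2
      rw [abs_le]
      push_cast at *
      omega

/-- Among the 27 triples over `{-1, 0, 1}`, the value bound removes all the unlisted ones except
`±(0, 1, -1)`; for these the digit bound would force `|C (n + 3)| ≥ 2`. -/
theorem mem_windows (h : IsQuotientSeq a β C) (hβ : 1 < β)
    (h1 : ∀ n, |C n| ≤ 1) (n : ℕ) : (C n, C (n + 1), C (n + 2)) ∈ windows := by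
  have v0 := abs_lt.1 (h.value n)
  have d0 := abs_le.1 (h.digit n)
  have b0 := abs_le.1 (h1 n)
  have b1 := abs_le.1 (h1 (n + 1))
  have b2 := abs_le.1 (h1 (n + 2))
  have b3 := abs_le.1 (h1 (n + 3))
  generalize C n = c0 at *
  generalize C (n + 1) = c1 at *
  generalize C (n + 2) = c2 at *
  generalize C (n + 3) = c3 at *
  obtain ⟨l0, u0⟩ := b0
  obtain ⟨l1, u1⟩ := b1
  obtain ⟨l2, u2⟩ := b2
  obtain ⟨l3, u3⟩ := b3
  have hsq : β < β ^ 2 := by nlinarith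
  interval_cases c0 <;> interval_cases c1 <;> interval_cases c2 <;>
    first
    | decide
    | (exfalso; obtain ⟨x, y⟩ := v0; push_cast at x y; linarith)

end IsQuotientSeq
end CubicRauzy

/-! ### Quotient sequences, convergence and the greedy bound -/

namespace CubicRauzy

open Filter Topology

/-- The sums `x^(-k+2) ∑_{i=l}^{k} δ_i x^i` over a field. -/
noncomputable def scaledSum {K : Type*} [Field K] (x : K) (l : ℤ) (δ : ℤ → K) (k : ℤ) : K :=
  x ^ (-k + 2) * ∑ i ∈ Finset.Icc l k, δ i * x ^ i

theorem scaledSum_of_lt {K : Type*} [Field K] (x : K) {l k : ℤ} (δ : ℤ → K) (h : k < l) :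
    scaledSum x l δ k = 0 := by
  simp [scaledSum, h]

theorem scaledSum_add_one {K : Type*} [Field K] {x : K} (hx : x ≠ 0) {l k : ℤ} (δ : ℤ → K)
    (h : l ≤ k + 1) :
    scaledSum x l δ (k + 1) = scaledSum x l δ k / x + δ (k + 1) * x ^ 2 := by
  have hI : Finset.Icc l (k + 1) = insert (k + 1) (Finset.Icc l k) := by
    ext i; simp only [Finset.mem_Icc, Finset.mem_insert]; omega
  have e1 : x ^ (-(k + 1) + 2) = x ^ (-k + 2) / x := by
    rw [show -(k + 1) + 2 = (-k + 2) - 1 by ring, zpow_sub_one₀ hx, div_eq_mul_inv]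
  have e2 : x ^ (-(k + 1) + 2) * x ^ (k + 1) = x ^ 2 := by
    rw [← zpow_add₀ hx, show -(k + 1) + 2 + (k + 1) = ((2 : ℕ) : ℤ) by ring, zpow_natCast]
  unfold scaledSum
  rw [hI, Finset.sum_insert (by simp), mul_add, mul_left_comm, e2, e1]
  ring

theorem partialDiff_eq_scaledSum (α : ℂ) (l : ℤ) (ε ε' : ℤ → ℕ) (k : ℤ) :
    partialDiff α l ε ε' k = scaledSum α l (fun i => (ε i : ℂ) - ε' i) k := rfl

/-- The value of an integer window at `x`. -/
def windowValue {K : Type*} [Field K] (x : K) (t : ℤ × ℤ × ℤ) : K :=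
  t.1 * x ^ 3 + t.2.1 * (x - x ^ 2) + t.2.2 * x ^ 2

/-- The three-term window of a sequence. -/
def window (C : ℕ → ℤ) (n : ℕ) : ℤ × ℤ × ℤ := (C n, C (n + 1), C (n + 2))

/-- `C` is the quotient of the power series `∑ δ_{l+n} x^n` by the reciprocal cubic polynomial. -/
structure IsQuotient (a : ℕ) (l : ℤ) (δ : ℤ → ℤ) (C : ℕ → ℤ) : Prop where
  zero : C 0 = 0 ∧ C 1 = 0 ∧ C 2 = 0
  digit : ∀ n : ℕ, C (n + 3) - C (n + 2) + a * C (n + 1) - C n = δ (l + n)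

/-- Auxiliary iteration producing the quotient sequence as moving windows. -/
def quotientWindow (a : ℕ) (l : ℤ) (δ : ℤ → ℤ) : ℕ → ℤ × ℤ × ℤ
  | 0 => (0, 0, 0)
  | n + 1 =>
    let t := quotientWindow a l δ n
    (t.2.1, t.2.2, δ (l + n) + t.2.2 - a * t.2.1 + t.1)

theorem exists_isQuotient (a : ℕ) (l : ℤ) (δ : ℤ → ℤ) : ∃ C, IsQuotient a l δ C := by
  refine ⟨fun n => (quotientWindow a l δ n).1, ⟨rfl, rfl, rfl⟩, fun n => ?_⟩
  simp only [quotientWindow]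
  ring

/-- One sequence `C` serves every root in every field, hence both `α` and `β`. The zero window at `n
= 0` matches the empty sum at index `l - 1`. -/
theorem IsQuotient.scaledSum_eq {a : ℕ} {l : ℤ} {δ : ℤ → ℤ} {C : ℕ → ℤ} (h : IsQuotient a l δ C)
    {K : Type*} [Field K] {x : K} (hx : x ^ 3 - a * x ^ 2 + x - 1 = 0) (n : ℕ) :
    scaledSum x l (fun i => (δ i : K)) (l - 1 + n) = windowValue x (window C n) := by
  have hx0 : x ≠ 0 := by rintro rfl; simp at hx
  induction n with
  | zero =>
    rw [scaledSum_of_lt _ _ (by simp)]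
    simp [windowValue, window, h.zero]
  | succ n ih =>
    push_cast
    rw [← add_assoc, scaledSum_add_one hx0 _ (by omega), ih,
      show l - 1 + (n : ℤ) + 1 = l + n by ring, ← h.digit n]
    simp only [windowValue, window]
    push_cast
    field_simp
    linear_combination -(C (n + 1) : K) * hx

/-! ### Convergence -/

section convergence
variable {a : ℕ} {α : ℂ}

theorem StartsAt.notMem_range {l : ℤ} {ε : ℤ → ℕ} (h : StartsAt l ε) {i : ℤ}
    (hi : i ∉ Set.range (fun n : ℕ => l + n)) : ε i = 0 := by
  apply h
  by_contra hc
  exact hi ⟨(i - l).toNat, by simp only []; omega⟩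

theorem shift_injective (l : ℤ) : Function.Injective (fun n : ℕ => l + (n : ℤ)) := fun m n h => by
  simpa using h

theorem summable_geometric_bounded (h1 : ‖α‖ < 1) (h0 : α ≠ 0) (l : ℤ) {f : ℤ → ℂ} {B : ℝ}
    (hf : ∀ i, ‖f i‖ ≤ B) : Summable fun n : ℕ => f (l + n) * α ^ (l + n) := by
  refine Summable.of_norm_bounded (g := fun n : ℕ => B * ‖α‖ ^ l * ‖α‖ ^ n)
    ((summable_geometric_of_lt_one (norm_nonneg _) h1).mul_left _) (fun n => ?_)
  rw [norm_mul, zpow_add₀ h0, norm_mul, norm_zpow, zpow_natCast, norm_pow, ← mul_assoc]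
  gcongr
  exact hf _

theorem norm_digit_le {ε : ℤ → ℕ} (hε : ∀ i, ε i < a) (i : ℤ) : ‖(ε i : ℂ)‖ ≤ a := by
  rw [Complex.norm_natCast]; exact_mod_cast (hε i).le

theorem summable_of_startsAt (h1 : ‖α‖ < 1) (h0 : α ≠ 0) {l : ℤ} {ε : ℤ → ℕ}
    (hε : ∀ i, ε i < a) (hl : StartsAt l ε) : Summable fun i : ℤ => (ε i : ℂ) * α ^ i := by
  rw [← (shift_injective l).summable_iff]
  · exact summable_geometric_bounded h1 h0 l (f := fun i => (ε i : ℂ)) (norm_digit_le hε)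
  · intro i hi
    rw [hl.notMem_range hi]; simp

theorem alphaSum_eq_tsum_nat {l : ℤ} {ε : ℤ → ℕ} (hl : StartsAt l ε) :
    alphaSum α ε = ∑' n : ℕ, (ε (l + n) : ℂ) * α ^ (l + n) := by
  unfold alphaSum
  refine ((shift_injective l).tsum_eq (f := fun i : ℤ => (ε i : ℂ) * α ^ i) ?_).symm
  intro i hi
  by_contra hc
  apply hi
  simp only
  rw [hl.notMem_range hc]; simp

theorem sum_Icc_eq_sum_range {M : Type*} [AddCommMonoid M] (l : ℤ) (f : ℤ → M) (n : ℕ) :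
    ∑ i ∈ Finset.Icc l (l - 1 + n), f i = ∑ m ∈ Finset.range n, f (l + m) := by
  induction n with
  | zero => simp
  | succ n ih =>
    have hI : Finset.Icc l (l - 1 + (n + 1 : ℕ)) = insert (l + n) (Finset.Icc l (l - 1 + n)) := by
      ext i; simp only [Finset.mem_Icc, Finset.mem_insert]; push_cast; omega
    rw [hI, Finset.sum_insert (by simp), ih, Finset.sum_range_succ, add_comm]

/-- The difference of two expansions as a series over `ℕ`. -/
theorem hasSum_diff (h1 : ‖α‖ < 1) (h0 : α ≠ 0) {l : ℤ} {ε ε' : ℤ → ℕ}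
    (hε : ∀ i, ε i < a) (hl : StartsAt l ε) (hε' : ∀ i, ε' i < a) (hl' : StartsAt l ε') :
    HasSum (fun n : ℕ => ((ε (l + n) : ℂ) - ε' (l + n)) * α ^ (l + n))
      (alphaSum α ε - alphaSum α ε') := by
  rw [alphaSum_eq_tsum_nat hl, alphaSum_eq_tsum_nat hl']
  have := (summable_geometric_bounded h1 h0 l (f := fun i => (ε i : ℂ))
    (norm_digit_le hε)).hasSum.sub (summable_geometric_bounded h1 h0 l (f := fun i => (ε' i : ℂ))
    (norm_digit_le hε')).hasSum
  simpa only [sub_mul] using this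

theorem pow_mul_partialDiff (h0 : α ≠ 0) (l : ℤ) (ε ε' : ℤ → ℕ) (n : ℕ) :
    α ^ (l - 3 + n) * partialDiff α l ε ε' (l - 1 + n) =
      ∑ m ∈ Finset.range n, ((ε (l + m) : ℂ) - ε' (l + m)) * α ^ (l + m) := by
  unfold partialDiff
  rw [← mul_assoc, ← zpow_add₀ h0,
    sum_Icc_eq_sum_range l (fun i => ((ε i : ℂ) - ε' i) * α ^ i)]
  rw [show l - 3 + (n : ℤ) + (-(l - 1 + n) + 2) = 0 by ring]
  simp

/-- The shift to `n + 1` skips the empty sum at `l - 1`, which is not in `S(ε, ε')`. -/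
theorem mem_diffSet_iff {l : ℤ} {ε ε' : ℤ → ℕ} {z : ℂ} :
    z ∈ diffSet α l ε ε' ↔ ∃ n : ℕ, z = partialDiff α l ε ε' (l - 1 + (n + 1 : ℕ)) := by
  constructor
  · rintro ⟨k, hk, rfl⟩
    refine ⟨(k - l).toNat, ?_⟩
    congr 1
    push_cast
    omega
  · rintro ⟨n, rfl⟩
    exact ⟨_, by push_cast; omega, rfl⟩

/-- The partial sums are `α ^ (k - 2) * A_k` with `A_k` bounded, so they tend to 0. -/
theorem alphaSum_eq_of_finite (h1 : ‖α‖ < 1) (h0 : α ≠ 0) {l : ℤ} {ε ε' : ℤ → ℕ}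
    (hε : ∀ i, ε i < a) (hl : StartsAt l ε) (hε' : ∀ i, ε' i < a) (hl' : StartsAt l ε')
    (hfin : (diffSet α l ε ε').Finite) : alphaSum α ε = alphaSum α ε' := by
  obtain ⟨B, hB⟩ := hfin.isBounded.exists_norm_le
  have t1 := ((hasSum_diff h1 h0 hε hl hε' hl').tendsto_sum_nat).comp (tendsto_add_atTop_nat 1)
  have t2 : Tendsto (fun n : ℕ => ∑ m ∈ Finset.range (n + 1),
      ((ε (l + m) : ℂ) - ε' (l + m)) * α ^ (l + m)) atTop (𝓝 0) := by
    have t3 : Tendsto (fun n : ℕ => ‖α‖ ^ (l - 2) * ‖α‖ ^ n * B) atTop (𝓝 0) := by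
      simpa using ((tendsto_pow_atTop_nhds_zero_of_lt_one (norm_nonneg α) h1).const_mul
        (‖α‖ ^ (l - 2))).mul_const B
    refine squeeze_zero_norm (fun n => ?_) t3
    rw [← pow_mul_partialDiff h0, norm_mul, norm_zpow, ← zpow_natCast, ← zpow_add₀ (by simpa)]
    have := hB _ (mem_diffSet_iff.2 ⟨n, rfl⟩)
    rw [show l - 3 + ((n + 1 : ℕ) : ℤ) = l - 2 + n by push_cast; ring]
    gcongr
  exact sub_eq_zero.1 (tendsto_nhds_unique t1 t2)

/-- When the total is zero, a partial sum is minus its tail; the scaling in `A_k` cancels the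
leading power of the tail, so the bound does not depend on `n`. -/
theorem norm_partialDiff_le (h1 : ‖α‖ < 1) (h0 : α ≠ 0) {l : ℤ} {ε ε' : ℤ → ℕ}
    (hε : ∀ i, ε i < a) (hl : StartsAt l ε) (hε' : ∀ i, ε' i < a) (hl' : StartsAt l ε')
    (heq : alphaSum α ε = alphaSum α ε') (n : ℕ) :
    ‖partialDiff α l ε ε' (l - 1 + n)‖ ≤ ‖α‖ ^ 3 * a * (1 - ‖α‖)⁻¹ := by
  have hs := hasSum_diff h1 h0 hε hl hε' hl'
  rw [heq, sub_self] at hs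
  have ht := hs.summable.sum_add_tsum_nat_add n
  rw [hs.tsum_eq, ← pow_mul_partialDiff h0] at ht
  have hpos : 0 < ‖α‖ := norm_pos_iff.2 h0
  have hb : ‖∑' m : ℕ, ((ε (l + (m + n : ℕ)) : ℂ) - ε' (l + (m + n : ℕ))) *
      α ^ (l + (m + n : ℕ))‖ ≤ ‖α‖ ^ (l + n) * a * (1 - ‖α‖)⁻¹ := by
    refine tsum_of_norm_bounded
      ((hasSum_geometric_of_lt_one (norm_nonneg α) h1).mul_left (‖α‖ ^ (l + n) * a)) (fun m => ?_)
    rw [norm_mul, norm_zpow, show l + ((m + n : ℕ) : ℤ) = l + n + m by push_cast; ring,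
      zpow_add₀ hpos.ne', zpow_natCast, mul_comm (‖_ - _‖)]
    have hd : ‖(ε (l + n + m) : ℂ) - ε' (l + n + m)‖ ≤ a := by
      have e1 := hε (l + n + m)
      have e2 := hε' (l + n + m)
      rw [show (ε (l + n + m) : ℂ) - ε' (l + n + m) =
        ((ε (l + n + m) : ℤ) - (ε' (l + n + m) : ℤ) : ℤ) by push_cast; rfl, Complex.norm_intCast]
      have : |(ε (l + n + m) : ℤ) - (ε' (l + n + m) : ℤ)| ≤ a := by rw [abs_le]; omega
      exact_mod_cast this
    calc ‖α‖ ^ (l + (n : ℤ)) * ‖α‖ ^ m * ‖(ε (l + n + m) : ℂ) - ε' (l + n + m)‖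
        ≤ ‖α‖ ^ (l + (n : ℤ)) * ‖α‖ ^ m * a := by gcongr
      _ = _ := by ring
  rw [← neg_eq_of_add_eq_zero_right ht, norm_neg, norm_mul, norm_zpow,
    show l + (n : ℤ) = (l - 3 + n) + 3 by ring, zpow_add₀ hpos.ne' (l - 3 + n) 3, mul_assoc,
    mul_assoc] at hb
  have := le_of_mul_le_mul_left hb (zpow_pos hpos _)
  rw [mul_assoc]
  exact_mod_cast this

end convergence

/-! ### Admissible digit sequences -/

/-- The lexicographic condition shared by `E(R)` and `E(G)`, at all indices. -/
def IsAdmissible (a : ℕ) (ε : ℤ → ℕ) : Prop :=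
  (∀ i, ε i < a) ∧ ∀ i, ε i = a - 1 → ε (i - 1) = a - 1 → ε (i - 2) = 0 ∧ ε (i - 3) = 0

theorem lex_lt_iff {a x y z w : ℕ} (hx : x < a) (hy : y < a) :
    [x, y, z, w] < [a - 1, a - 1, 0, 1] ↔ (x = a - 1 → y = a - 1 → z = 0 ∧ w = 0) := by
  simp only [List.cons_lt_cons_iff, List.not_lt_nil, and_false, or_false]
  omega

theorem isAdmissible_of_mem_ER {a : ℕ} (ha : 2 ≤ a) {ε : ℤ → ℕ} (h : ε ∈ ER a) :
    IsAdmissible a ε := by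
  obtain ⟨h1, k, -, hk, hlex⟩ := h
  refine ⟨h1, fun i => ?_⟩
  rcases lt_or_ge i k with hi | hi
  -- Below `k` the digit is 0, whereas `a - 1 ≥ 1`, so the condition is vacuous.
  · intro e
    rw [hk i hi] at e
    omega
  · exact (lex_lt_iff (h1 _) (h1 _)).1 (hlex i hi)

theorem EG_subset_ER (a : ℕ) : EG a ⊆ ER a := by
  rintro ε ⟨h1, k, h2, h3, h4, -⟩
  exact ⟨h1, k, h2, h3, h4⟩

theorem exists_startsAt_of_mem_ER {a : ℕ} {ε : ℤ → ℕ} (h : ε ∈ ER a) : ∃ l, StartsAt l ε := by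
  obtain ⟨-, k, -, hk, -⟩ := h
  exact ⟨k, hk⟩

/-- The greedy bound: the finite `β`-expansions given by admissible digits are less than `β`. -/
theorem IsAdmissible.lt_of_rec {a : ℕ} {β : ℝ} {ε : ℤ → ℕ} (h : IsAdmissible a ε)
    (hβ : 1 < β) (hu : (a : ℝ) - 1 < β) (hroot : β ^ 3 - a * β ^ 2 + β - 1 = 0) {T : ℤ → ℝ} {l : ℤ}
    (hrec : ∀ k, T k = ε k + T (k - 1) / β) (hz : ∀ k < l, T k = 0) (k : ℤ) :
    T k < β := by
  have hpos : 0 < β := by linarith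
  have main : ∀ n : ℕ, ∀ k < l + n, T k < β := by
    intro n
    induction n with
    | zero => intro k hk; rw [hz k (by simpa using hk)]; exact hpos
    | succ n ih =>
      intro k hk
      -- After a non-maximal digit, the inductive bound `T / β < 1` already suffices.
      have small : ∀ j ≤ k, ε j + 2 ≤ a → T j < a - 1 := by
        intro j hj hε
        have h1 := ih (j - 1) (by push_cast at hk; omega)
        have h2 : T (j - 1) / β < 1 := by rwa [div_lt_one hpos]
        have h3 : (ε j : ℝ) + 2 ≤ a := by exact_mod_cast hε
        rw [hrec j]; linarith
      rcases Nat.lt_or_ge (ε k + 1) a with hk1 | hk1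
      · linarith [small k le_rfl hk1]
      have ek : ε k = a - 1 := by have := h.1 k; omega
      have ha1 : 1 ≤ a := by have := h.1 k; omega
      have hsuff : T (k - 1) < a - 1 + 1 / β ^ 2 := by
        rcases Nat.lt_or_ge (ε (k - 1) + 1) a with hk2 | hk2
        · have : 0 < 1 / β ^ 2 := by positivity
          linarith [small (k - 1) (by omega) hk2]
        · have ek1 : ε (k - 1) = a - 1 := by have := h.1 (k - 1); omega
          -- Two maximal digits force two zeros, so the recursion runs back to `T (k - 4)` at once.
          obtain ⟨z1, z2⟩ := h.2 k ek ek1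
          have h4 := ih (k - 4) (by push_cast at hk; omega)
          have r1 := hrec (k - 1)
          have r2 := hrec (k - 1 - 1)
          have r3 := hrec (k - 1 - 1 - 1)
          rw [show k - 1 - 1 - 1 - 1 = k - 4 by ring, show k - 1 - 1 - 1 = k - 3 by ring, z2] at r3
          rw [show k - 1 - 1 - 1 = k - 3 by ring, show k - 1 - 1 = k - 2 by ring, z1, r3] at r2
          rw [show k - 1 - 1 = k - 2 by ring, ek1, r2] at r1
          push_cast [Nat.cast_sub ha1] at r1
          rw [r1]
          have h5 : T (k - 4) / β < 1 := by rwa [div_lt_one hpos]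
          have h6 : (0 + (0 + T (k - 4) / β) / β) / β = (T (k - 4) / β) / β ^ 2 := by
            field_simp; ring
          rw [h6]
          gcongr
      -- The word `(a-1)(a-1)01` expands `β` itself: its quartic is `β + 1` times the cubic.
      have hid : ((a : ℝ) - 1) + (a - 1 + 1 / β ^ 2) / β = β := by
        field_simp
        linear_combination -(β + 1) * hroot
      rw [hrec k, ek, Nat.cast_sub ha1, Nat.cast_one]
      calc (a : ℝ) - 1 + T (k - 1) / β < a - 1 + (a - 1 + 1 / β ^ 2) / β := by gcongr
        _ = β := hid
  exact main (k - l + 1).toNat k (by omega)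

theorem IsAdmissible.scaledSum_bounds {a : ℕ} {β : ℝ} {ε : ℤ → ℕ} (h : IsAdmissible a ε)
    (hβ : 1 < β) (hu : (a : ℝ) - 1 < β) (hroot : β ^ 3 - a * β ^ 2 + β - 1 = 0) {l : ℤ}
    (hl : StartsAt l ε) (k : ℤ) :
    0 ≤ scaledSum β l (fun i => (ε i : ℝ)) k ∧ scaledSum β l (fun i => (ε i : ℝ)) k < β ^ 3 := by
  have hpos : 0 < β := by linarith
  constructor
  · unfold scaledSum; positivity
  -- Dividing by `β²` leaves `∑ ε_i β^(i-k)`, which satisfies the greedy recursion.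
  · have := h.lt_of_rec hβ hu hroot (l := l)
      (T := fun k => scaledSum β l (fun i => (ε i : ℝ)) k / β ^ 2) ?_ ?_ k
    · rw [div_lt_iff₀ (by positivity)] at this
      calc _ < β * β ^ 2 := this
        _ = β ^ 3 := by ring
    · intro k
      rcases lt_or_ge k l with hk | hk
      · rw [scaledSum_of_lt _ _ hk, scaledSum_of_lt _ _ (by omega), hl k hk]; simp
      · have := scaledSum_add_one hpos.ne' (k := k - 1) (fun i => (ε i : ℝ))
          (by omega : l ≤ k - 1 + 1)
        rw [sub_add_cancel] at this
        rw [this]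
        field_simp
        ring
    · intro k hk
      rw [scaledSum_of_lt _ _ hk, zero_div]

end CubicRauzy

/-! ### Windows, states and automaton paths -/

namespace CubicRauzy

variable {a : ℕ} {α : ℂ} {β : ℝ}

theorem windowValue_eq_combination (hα : α ^ 3 - (a : ℂ) * α ^ 2 + α - 1 = 0) (t : ℤ × ℤ × ℤ) :
    windowValue α t =
      t.1 + ((t.2.1 - t.1 : ℤ) : ℂ) * α + ((t.2.2 - t.2.1 + a * t.1 : ℤ) : ℂ) * α ^ 2 := by
  unfold windowValue
  push_cast
  linear_combination (t.1 : ℂ) * hα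

/-- In the basis `1, α, α²` the window coordinates transform unitriangularly, so integral
independence suffices. -/
theorem windowValue_injective (h : IsRealConjugate a α β) (him : α.im ≠ 0)
    (hα : α ^ 3 - (a : ℂ) * α ^ 2 + α - 1 = 0) :
    Function.Injective (windowValue α) := by
  rintro ⟨u, v, w⟩ ⟨u', v', w'⟩ e
  have e1 : windowValue α (u - u', v - v', w - w') = 0 := by
    rw [← sub_eq_zero] at e
    rw [← e]
    simp only [windowValue]
    push_cast
    ring
  rw [windowValue_eq_combination hα] at e1
  obtain ⟨h1, h2, h3⟩ := h.eq_zero_of_combination him e1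
  simp only at h1 h2 h3
  rw [h1, mul_zero] at h3
  simp only [Prod.mk.injEq]
  omega

theorem stateSet_eq_image (hα : α ^ 3 - (a : ℂ) * α ^ 2 + α - 1 = 0) :
    stateSet a α = windowValue α '' (windows : Set (ℤ × ℤ × ℤ)) := by
  have h3 : α ^ 3 = a * α ^ 2 - α + 1 := by linear_combination hα
  ext z
  simp only [stateSet, windows, windowValue, Finset.coe_insert, Finset.coe_singleton,
    Set.image_insert_eq, Set.image_singleton, Set.mem_insert_iff, Set.mem_singleton_iff,
    Set.mem_ofPred_eq, exists_eq_or_imp, exists_eq_left, h3]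
  push_cast
  ring_nf
  tauto

theorem ncard_stateSet (h : IsRealConjugate a α β) (him : α.im ≠ 0)
    (hα : α ^ 3 - (a : ℂ) * α ^ 2 + α - 1 = 0) : (stateSet a α).ncard = 15 := by
  rw [stateSet_eq_image hα, Set.ncard_image_of_injective _ (windowValue_injective h him hα),
    Set.ncard_coe_finset, card_windows]

theorem finite_stateSet (hα : α ^ 3 - (a : ℂ) * α ^ 2 + α - 1 = 0) : (stateSet a α).Finite := by
  rw [stateSet_eq_image hα]
  exact windows.finite_toSet.image _

theorem finite_edges (hα : α ^ 3 - (a : ℂ) * α ^ 2 + α - 1 = 0) :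
    (automaton a α).edges.Finite := by
  refine ((finite_stateSet hα).prod (((Set.finite_Iio a).prod (Set.finite_Iio a)).prod
    (finite_stateSet hα))).subset ?_
  rintro _ ⟨s, hs, t, ht, e, he, f, hf, -, rfl⟩
  exact ⟨hs, ⟨he, hf⟩, ht⟩

theorem partialDiff_eq_windowValue (hα : α ^ 3 - (a : ℂ) * α ^ 2 + α - 1 = 0) {l : ℤ}
    {ε ε' : ℤ → ℕ} {C : ℕ → ℤ} (hC : IsQuotient a l (fun i => (ε i : ℤ) - ε' i) C) (n : ℕ) :
    partialDiff α l ε ε' (l - 1 + n) = windowValue α (window C n) := by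
  rw [← hC.scaledSum_eq hα n, partialDiff_eq_scaledSum]
  congr 1
  funext i
  push_cast
  rfl

theorem scaledSum_sub {K : Type*} [Field K] (x : K) (l : ℤ) (δ δ' : ℤ → K) (k : ℤ) :
    scaledSum x l (fun i => δ i - δ' i) k = scaledSum x l δ k - scaledSum x l δ' k := by
  simp only [scaledSum, sub_mul, Finset.sum_sub_distrib, mul_sub]

theorem abs_windowValue_lt (h : IsRealConjugate a α β) (ha : 2 ≤ a) {l : ℤ} {ε ε' : ℤ → ℕ}
    {C : ℕ → ℤ} (hC : IsQuotient a l (fun i => (ε i : ℤ) - ε' i) C) (hε : IsAdmissible a ε)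
    (hε' : IsAdmissible a ε') (hl : StartsAt l ε) (hl' : StartsAt l ε') (n : ℕ) :
    |windowValue β (window C n)| < β ^ 3 := by
  have hu : (a : ℝ) - 1 < β := by linarith [h.lower]
  rw [← hC.scaledSum_eq h.root]
  push_cast
  rw [scaledSum_sub β l (fun i => (ε i : ℝ)) (fun i => (ε' i : ℝ)), abs_lt]
  obtain ⟨b1, b2⟩ := hε.scaledSum_bounds (h.one_lt ha) hu h.root hl (l - 1 + n)
  obtain ⟨b3, b4⟩ := hε'.scaledSum_bounds (h.one_lt ha) hu h.root hl' (l - 1 + n)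
  constructor <;> linarith

/-- Equal sums force the windows of the quotient sequence into the list `windows`. -/
theorem window_mem_of_alphaSum_eq (h : IsRealConjugate a α β) (ha : 2 ≤ a) (him : α.im ≠ 0)
    (hα : α ^ 3 - (a : ℂ) * α ^ 2 + α - 1 = 0) {l : ℤ} {ε ε' : ℤ → ℕ}
    {C : ℕ → ℤ} (hC : IsQuotient a l (fun i => (ε i : ℤ) - ε' i) C) (hε : IsAdmissible a ε)
    (hε' : IsAdmissible a ε') (hl : StartsAt l ε) (hl' : StartsAt l ε')
    (heq : alphaSum α ε = alphaSum α ε') (n : ℕ) : window C n ∈ windows := by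
  have hβ := h.one_lt ha
  have h0 : α ≠ 0 := by rintro rfl; simp at him
  have hval := abs_windowValue_lt h ha hC hε hε' hl hl'
  have hQ : IsQuotientSeq a β C := by
    refine ⟨fun n => ?_, fun n => ?_⟩
    · rw [hC.digit n, abs_le]
      have := hε.1 (l + n)
      have := hε'.1 (l + n)
      omega
    · have e : windowValue β (window C n) =
          β * (C n * β ^ 2 + C (n + 1) * (1 - β) + C (n + 2) * β) := by
        simp only [windowValue, window]; ring
      have h1 := hval n
      rw [e, abs_mul, abs_of_pos (by linarith), pow_succ' β 2] at h1
      exact lt_of_mul_lt_mul_left h1 (by linarith)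
  obtain ⟨B, hB⟩ := h.exists_coeff_bound ha him (‖α‖ ^ 3 * a * (1 - ‖α‖)⁻¹) (β ^ 3)
  -- The same integer coefficients are bounded at `α` by the tail estimate and at `β` by the greedy
  -- estimate.
  have hM : ∀ n, |C n| ≤ (⌈B⌉₊ : ℤ) := by
    intro n
    have h1 := norm_partialDiff_le (h.norm_lt_one ha) h0 hε.1 hl hε'.1 hl' heq n
    rw [partialDiff_eq_windowValue hα hC, windowValue_eq_combination hα] at h1
    have h2 := (hval n).le
    have e : windowValue β (window C n) = C n + ((C (n + 1) - C n : ℤ) : ℝ) * β +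
        ((C (n + 2) - C (n + 1) + a * C n : ℤ) : ℝ) * β ^ 2 := by
      simp only [windowValue, window]
      push_cast
      linear_combination (C n : ℝ) * h.root
    rw [e] at h2
    have h3 := (hB (C n) ((C (n + 1) - C n : ℤ) : ℝ)
      ((C (n + 2) - C (n + 1) + a * C n : ℤ) : ℝ) (by simpa [window] using h1) h2).1
    have h4 : |(C n : ℝ)| ≤ ⌈B⌉₊ := h3.trans (Nat.le_ceil _)
    exact_mod_cast h4
  exact hQ.mem_windows hβ (hQ.abs_le_one ha h.root h.lower h.upper hM) n

/-- A path of the automaton is the sequence of partial differences. -/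
theorem recognizes_iff (h0 : α ≠ 0) {l : ℤ} {ε ε' : ℤ → ℕ} (hε : ∀ i, ε i < a)
    (hε' : ∀ i, ε' i < a) :
    (automaton a α).Recognizes (pairWord l ε ε') ↔ diffSet α l ε ε' ⊆ stateSet a α := by
  have hrec : ∀ n : ℕ, partialDiff α l ε ε' (l - 1 + (n + 1 : ℕ)) =
      partialDiff α l ε ε' (l - 1 + n) / α + ((ε (l + n) : ℂ) - ε' (l + n)) * α ^ 2 := by
    intro n
    simp only [partialDiff_eq_scaledSum]
    push_cast
    rw [← add_assoc, scaledSum_add_one h0 _ (by omega), show l - 1 + (n : ℤ) + 1 = l + n by ring]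
  have hzero : partialDiff α l ε ε' (l - 1 + (0 : ℕ)) = 0 :=
    scaledSum_of_lt _ _ (by simp)
  constructor
  · rintro ⟨q, hq0, hq, hedge⟩ z hz
    obtain ⟨n, rfl⟩ := mem_diffSet_iff.1 hz
    have hpath : ∀ n : ℕ, q n = partialDiff α l ε ε' (l - 1 + n) := by
      intro n
      induction n with
      | zero => rw [hzero]; exact hq0
      | succ n ih =>
        obtain ⟨s, -, t, -, e, -, f, -, ht, heq⟩ := hedge n
        simp only [pairWord, Prod.mk.injEq] at heq
        obtain ⟨rfl, ⟨rfl, rfl⟩, rfl⟩ := heq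
        rw [ht, hrec, ih]
    rw [← hpath]
    exact hq _
  · intro hsub
    have hmem : ∀ n : ℕ, partialDiff α l ε ε' (l - 1 + n) ∈ stateSet a α := by
      rintro (_ | n)
      · rw [hzero]; exact Or.inl rfl
      · exact hsub (mem_diffSet_iff.2 ⟨n, rfl⟩)
    exact ⟨fun n => partialDiff α l ε ε' (l - 1 + n), hzero, hmem, fun n =>
      ⟨_, hmem n, _, hmem (n + 1), _, hε _, _, hε' _, hrec n, rfl⟩⟩

/-- Digit sequences whose quotient sequence takes few values have equal sums. -/
theorem alphaSum_eq_of_quotient (h : IsRealConjugate a α β) (ha : 2 ≤ a) (him : α.im ≠ 0)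
    (hα : α ^ 3 - (a : ℂ) * α ^ 2 + α - 1 = 0) {l : ℤ} {ε ε' : ℤ → ℕ} {C : ℕ → ℤ}
    (hC : IsQuotient a l (fun i => (ε i : ℤ) - ε' i) C) (hb : (Set.range C).Finite)
    (hε : ∀ i, ε i < a) (hε' : ∀ i, ε' i < a) (hl : StartsAt l ε) (hl' : StartsAt l ε') :
    alphaSum α ε = alphaSum α ε' := by
  have h0 : α ≠ 0 := by rintro rfl; simp at him
  refine alphaSum_eq_of_finite (h.norm_lt_one ha) h0 hε hl hε' hl' ?_
  refine ((hb.prod (hb.prod hb)).image (windowValue α)).subset ?_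
  intro z hz
  obtain ⟨n, rfl⟩ := mem_diffSet_iff.1 hz
  rw [partialDiff_eq_windowValue hα hC]
  exact ⟨_, ⟨⟨_, rfl⟩, ⟨_, rfl⟩, ⟨_, rfl⟩⟩, rfl⟩

end CubicRauzy

/-! ### Explicit pairs realizing all states -/

namespace CubicRauzy

/-- A convenient sufficient condition for membership in `E(G)`: the first digit is `1` at index `0`,
followed by four zeros. -/
theorem mem_EG_of_isAdmissible {a : ℕ} (ha : 2 ≤ a) {ε : ℤ → ℕ} (h : IsAdmissible a ε)
    (hneg : ∀ i < 0, ε i = 0) (h0 : ε 0 = 1) (h1 : ε 1 = 0) (h2 : ε 2 = 0) : ε ∈ EG a := by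
  refine ⟨h.1, 0, by omega, hneg, fun i _ => (lex_lt_iff (h.1 _) (h.1 _)).2 (h.2 i), h.1 _, ?_, ?_⟩
  · simp only [zero_add, h1, List.cons_lt_cons_iff]
    left; omega
  · simp only [zero_add, h2, List.cons_lt_cons_iff]
    left; omega

/-- Quotient sequence `… 0 0 1 1 -1 -1 1 1 …`. -/
def alternatingQuotient (n : ℕ) : ℤ := if n < 8 then 0 else if n % 4 < 2 then 1 else -1

/-- Larger expansion belonging to `alternatingQuotient`. -/
def alternatingUpper (a : ℕ) (i : ℤ) : ℕ :=
  if i < 8 then (if i = 0 ∨ i = 5 then 1 else if i = 7 then a - 2 else 0)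
  else if i % 4 = 0 ∨ i % 4 = 3 then a - 1 else 0

/-- Smaller expansion belonging to `alternatingQuotient`. -/
def alternatingLower (a : ℕ) (i : ℤ) : ℕ :=
  if i < 8 then (if i = 0 then 1 else 0)
  else if i % 4 = 1 ∨ i % 4 = 2 then a - 1 else 0

/-- Quotient sequence `… 0 0 1 1 0 -1 0 1 0 -1 …`. -/
def sparseQuotient (n : ℕ) : ℤ :=
  if n < 8 then 0 else if n = 8 then 1 else if n % 4 = 1 then 1 else if n % 4 = 3 then -1 else 0

/-- Larger expansion belonging to `sparseQuotient`. -/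
def sparseUpper (a : ℕ) (i : ℤ) : ℕ :=
  if i < 9 then (if i = 0 ∨ i = 5 then 1 else if i = 7 then a - 1 else if i = 8 then a - 2 else 0)
  else if i % 4 = 0 then a - 1 else 0

/-- Smaller expansion belonging to `sparseQuotient`. -/
def sparseLower (a : ℕ) (i : ℤ) : ℕ :=
  if i < 9 then (if i = 0 then 1 else 0)
  else if i % 4 = 2 then a - 1 else 0

variable {a : ℕ}

theorem alternatingUpper_mem (ha : 2 ≤ a) : alternatingUpper a ∈ EG a := by
  refine mem_EG_of_isAdmissible ha ⟨fun i => ?_, fun i => ?_⟩ (fun i hi => ?_) ?_ ?_ ?_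
  · grind [alternatingUpper]
  · grind [alternatingUpper]
  · grind [alternatingUpper]
  all_goals rfl

theorem alternatingLower_mem (ha : 2 ≤ a) : alternatingLower a ∈ EG a := by
  refine mem_EG_of_isAdmissible ha ⟨fun i => ?_, fun i => ?_⟩ (fun i hi => ?_) ?_ ?_ ?_
  · grind [alternatingLower]
  · grind [alternatingLower]
  · grind [alternatingLower]
  all_goals rfl

theorem sparseUpper_mem (ha : 2 ≤ a) : sparseUpper a ∈ EG a := by
  refine mem_EG_of_isAdmissible ha ⟨fun i => ?_, fun i => ?_⟩ (fun i hi => ?_) ?_ ?_ ?_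
  · grind [sparseUpper]
  · grind [sparseUpper]
  · grind [sparseUpper]
  all_goals rfl

theorem sparseLower_mem (ha : 2 ≤ a) : sparseLower a ∈ EG a := by
  refine mem_EG_of_isAdmissible ha ⟨fun i => ?_, fun i => ?_⟩ (fun i hi => ?_) ?_ ?_ ?_
  · grind [sparseLower]
  · grind [sparseLower]
  · grind [sparseLower]
  all_goals rfl

/-- The digits are the positive and negative parts of the differences computed from `C`, plus a
common leading 1 at index 0. The late onset of `C` leaves zeros after that 1, as the initial
conditions of `E(G)` require. -/
theorem alternating_isQuotient (ha : 2 ≤ a) :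
    IsQuotient a 0 (fun i => (alternatingUpper a i : ℤ) - alternatingLower a i)
      alternatingQuotient := by
  refine ⟨⟨rfl, rfl, rfl⟩, fun n => ?_⟩
  grind [alternatingUpper, alternatingLower, alternatingQuotient]

theorem sparse_isQuotient (ha : 2 ≤ a) :
    IsQuotient a 0 (fun i => (sparseUpper a i : ℤ) - sparseLower a i) sparseQuotient := by
  refine ⟨⟨rfl, rfl, rfl⟩, fun n => ?_⟩
  grind (splits := 30) [sparseUpper, sparseLower, sparseQuotient]

theorem finite_range_alternatingQuotient : (Set.range alternatingQuotient).Finite := by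
  refine (Set.finite_Icc (-1) 1).subset ?_
  rintro _ ⟨n, rfl⟩
  simp only [alternatingQuotient, Set.mem_Icc]
  split_ifs <;> omega

theorem finite_range_sparseQuotient : (Set.range sparseQuotient).Finite := by
  refine (Set.finite_Icc (-1) 1).subset ?_
  rintro _ ⟨n, rfl⟩
  simp only [sparseQuotient, Set.mem_Icc]
  split_ifs <;> omega

end CubicRauzy

namespace CubicRauzy
variable {a : ℕ}

theorem IsQuotient.swap {l : ℤ} {ε ε' : ℤ → ℕ} {C : ℕ → ℤ}
    (h : IsQuotient a l (fun i => (ε i : ℤ) - ε' i) C) :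
    IsQuotient a l (fun i => (ε' i : ℤ) - ε i) (-C) := by
  refine ⟨by simpa using h.zero, fun n => ?_⟩
  have := h.digit n
  simp only [Pi.neg_apply]
  linarith

theorem startsAt_zero_alternating_sparse :
    StartsAt 0 (alternatingUpper a) ∧ StartsAt 0 (alternatingLower a) ∧
      StartsAt 0 (sparseUpper a) ∧ StartsAt 0 (sparseLower a) := by
  refine ⟨fun i hi => ?_, fun i hi => ?_, fun i hi => ?_, fun i hi => ?_⟩
  · grind [alternatingUpper]
  · grind [alternatingLower]
  · grind [sparseUpper]
  · grind [sparseLower]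

/-- The window `t` occurs for a pair of sequences in `E(G)` with a finitely valued quotient. -/
def OccursInEG (a : ℕ) (t : ℤ × ℤ × ℤ) : Prop :=
  ∃ ε ∈ EG a, ∃ ε' ∈ EG a, ∃ C : ℕ → ℤ, StartsAt 0 ε ∧ StartsAt 0 ε' ∧
      IsQuotient a 0 (fun i => (ε i : ℤ) - ε' i) C ∧ (Set.range C).Finite ∧
      ∃ n : ℕ, window C (n + 1) = t

/-- Each window is read off one of the two sequences; swapping the expansions negates it. -/
theorem occursInEG_of_mem_windows (ha : 2 ≤ a) {t : ℤ × ℤ × ℤ} (ht : t ∈ windows) :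
    OccursInEG a t := by
  obtain ⟨s1, s2, s3, s4⟩ := startsAt_zero_alternating_sparse (a := a)
  have hneg : ∀ {C : ℕ → ℤ}, (Set.range C).Finite → (Set.range (-C)).Finite := fun {C} h =>
    (h.image Neg.neg).subset (by rintro _ ⟨n, rfl⟩; exact ⟨_, ⟨n, rfl⟩, rfl⟩)
  have hA : ∀ n, window alternatingQuotient (n + 1) = t → OccursInEG a t := fun n hn =>
    ⟨_, alternatingUpper_mem ha, _, alternatingLower_mem ha, _, s1, s2, alternating_isQuotient ha,
      finite_range_alternatingQuotient, n, hn⟩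
  have hA' : ∀ n, window (-alternatingQuotient) (n + 1) = t → OccursInEG a t := fun n hn =>
    ⟨_, alternatingLower_mem ha, _, alternatingUpper_mem ha, _, s2, s1,
      (alternating_isQuotient ha).swap, hneg finite_range_alternatingQuotient, n, hn⟩
  have hS : ∀ n, window sparseQuotient (n + 1) = t → OccursInEG a t := fun n hn =>
    ⟨_, sparseUpper_mem ha, _, sparseLower_mem ha, _, s3, s4, sparse_isQuotient ha,
      finite_range_sparseQuotient, n, hn⟩
  have hS' : ∀ n, window (-sparseQuotient) (n + 1) = t → OccursInEG a t := fun n hn =>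
    ⟨_, sparseLower_mem ha, _, sparseUpper_mem ha, _, s4, s3,
      (sparse_isQuotient ha).swap, hneg finite_range_sparseQuotient, n, hn⟩
  simp only [windows, Finset.mem_insert, Finset.mem_singleton] at ht
  rcases ht with rfl | rfl | rfl | rfl | rfl | rfl | rfl | rfl | rfl | rfl | rfl | rfl | rfl | rfl |
    rfl
  · exact hA 0 rfl
  · exact hA 6 rfl
  · exact hA' 6 rfl
  · exact hA 5 rfl
  · exact hA' 5 rfl
  · exact hS 11 rfl
  · exact hS' 11 rfl
  · exact hS 7 rfl
  · exact hS' 7 rfl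
  · exact hA 7 rfl
  · exact hA' 7 rfl
  · exact hS 8 rfl
  · exact hS' 8 rfl
  · exact hA 8 rfl
  · exact hA' 8 rfl

end CubicRauzy

/-! ### The main theorem -/

open CubicRauzy

theorem theorem4p2 (a : ℕ) (ha : 2 ≤ a) (α : ℂ)
    (hα : α ^ 3 - (a : ℂ) * α ^ 2 + α - 1 = 0) (hα_nonreal : α.im ≠ 0) :
    (CubicRauzy.stateSet a α).ncard = 15 ∧
    (CubicRauzy.automaton a α).states.Finite ∧
    (CubicRauzy.automaton a α).edges.Finite ∧
    ∀ X : Set (ℤ → ℕ), (X = CubicRauzy.ER a ∨ X = CubicRauzy.EG a) →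
      (∀ ε ∈ X, Summable fun i : ℤ => (ε i : ℂ) * α ^ i) ∧
      (∀ (l : ℤ) (ε ε' : ℤ → ℕ), ε ∈ X → ε' ∈ X →
        CubicRauzy.StartsAt l ε → CubicRauzy.StartsAt l ε' →
        (CubicRauzy.alphaSum α ε = CubicRauzy.alphaSum α ε' ↔
          (CubicRauzy.diffSet α l ε ε').Finite) ∧
        (CubicRauzy.alphaSum α ε = CubicRauzy.alphaSum α ε' →
          CubicRauzy.diffSet α l ε ε' ⊆ CubicRauzy.stateSet a α) ∧
        (CubicRauzy.alphaSum α ε = CubicRauzy.alphaSum α ε' ↔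
          (CubicRauzy.automaton a α).Recognizes (CubicRauzy.pairWord l ε ε'))) ∧
      CubicRauzy.stateSet a α =
        ⋃ d ∈ CubicRauzy.Delta X α, CubicRauzy.diffSet α d.1 d.2.1 d.2.2 ∧
      (∀ z : ℂ,
        (∃ ε ∈ X, ∃ ε' ∈ X, ε ≠ ε' ∧
          CubicRauzy.alphaSum α ε = z ∧ CubicRauzy.alphaSum α ε' = z) ↔
        (∃ (l : ℤ), ∃ ε ∈ X, ∃ ε' ∈ X, ε ≠ ε' ∧
          CubicRauzy.StartsAt l ε ∧ CubicRauzy.StartsAt l ε' ∧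
          (CubicRauzy.automaton a α).Recognizes (CubicRauzy.pairWord l ε ε') ∧
          CubicRauzy.alphaSum α ε = z)) := by
  obtain ⟨β, h⟩ := exists_realConjugate ha hα hα_nonreal
  have h0 : α ≠ 0 := by rintro rfl; simp at hα_nonreal
  have h1 := h.norm_lt_one ha
  refine ⟨ncard_stateSet h hα_nonreal hα, finite_stateSet hα, finite_edges hα, ?_⟩
  intro X hX
  -- Restrictions on states use only `E(R)`, while the witnesses lie in `E(G)`; these inclusions
  -- treat both choices of `X` together.
  have hXR : X ⊆ ER a := by
    rcases hX with rfl | rfl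
    · exact subset_rfl
    · exact EG_subset_ER a
  have hGX : EG a ⊆ X := by
    rcases hX with rfl | rfl
    · exact EG_subset_ER a
    · exact subset_rfl
  have adm : ∀ ε ∈ X, IsAdmissible a ε := fun ε hε => isAdmissible_of_mem_ER ha (hXR hε)
  have sub : ∀ (l : ℤ) (ε ε' : ℤ → ℕ), ε ∈ X → ε' ∈ X → StartsAt l ε → StartsAt l ε' →
      alphaSum α ε = alphaSum α ε' → diffSet α l ε ε' ⊆ stateSet a α := by
    intro l ε ε' hε hε' hl hl' heq z hz
    obtain ⟨C, hC⟩ := exists_isQuotient a l (fun i => (ε i : ℤ) - ε' i)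
    obtain ⟨n, rfl⟩ := mem_diffSet_iff.1 hz
    rw [partialDiff_eq_windowValue hα hC, stateSet_eq_image hα]
    exact ⟨_, window_mem_of_alphaSum_eq h ha hα_nonreal hα hC (adm ε hε) (adm ε' hε') hl hl' heq _,
      rfl⟩
  have eq_of_finite : ∀ (l : ℤ) (ε ε' : ℤ → ℕ), ε ∈ X → ε' ∈ X → StartsAt l ε → StartsAt l ε' →
      (diffSet α l ε ε').Finite → alphaSum α ε = alphaSum α ε' :=
    fun l ε ε' hε hε' hl hl' =>
      alphaSum_eq_of_finite h1 h0 (adm ε hε).1 hl (adm ε' hε').1 hl'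
  have rec_iff : ∀ (l : ℤ) (ε ε' : ℤ → ℕ), ε ∈ X → ε' ∈ X → StartsAt l ε → StartsAt l ε' →
      (alphaSum α ε = alphaSum α ε' ↔ (automaton a α).Recognizes (pairWord l ε ε')) := by
    intro l ε ε' hε hε' hl hl'
    rw [recognizes_iff h0 (adm ε hε).1 (adm ε' hε').1]
    exact ⟨sub l ε ε' hε hε' hl hl', fun hs =>
      eq_of_finite l ε ε' hε hε' hl hl' ((finite_stateSet hα).subset hs)⟩
  refine ⟨?_, ?_, ?_, ?_⟩
  · intro ε hε
    obtain ⟨l, hl⟩ := exists_startsAt_of_mem_ER (hXR hε)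
    exact summable_of_startsAt h1 h0 (adm ε hε).1 hl
  · intro l ε ε' hε hε' hl hl'
    exact ⟨⟨fun heq => (finite_stateSet hα).subset (sub l ε ε' hε hε' hl hl' heq),
      eq_of_finite l ε ε' hε hε' hl hl'⟩, sub l ε ε' hε hε' hl hl', rec_iff l ε ε' hε hε' hl hl'⟩
  · apply Set.Subset.antisymm
    · intro z hz
      rw [stateSet_eq_image hα] at hz
      obtain ⟨t, ht, rfl⟩ := hz
      obtain ⟨ε, hε, ε', hε', C, hl, hl', hC, hfin, n, rfl⟩ := occursInEG_of_mem_windows ha ht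
      have heq := alphaSum_eq_of_quotient h ha hα_nonreal hα hC hfin (adm ε (hGX hε)).1
        (adm ε' (hGX hε')).1 hl hl'
      refine Set.mem_biUnion (x := (0, ε, ε')) ⟨hGX hε, hGX hε', hl, hl', heq⟩ ?_
      exact mem_diffSet_iff.2 ⟨n, (partialDiff_eq_windowValue hα hC (n + 1)).symm⟩
    · refine Set.iUnion₂_subset ?_
      rintro ⟨l, ε, ε'⟩ ⟨hε, hε', hl, hl', heq⟩
      exact sub l ε ε' hε hε' hl hl' heq
  · intro z
    constructor
    · rintro ⟨ε, hε, ε', hε', hne, rfl, heq⟩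
      obtain ⟨l, hl⟩ := exists_startsAt_of_mem_ER (hXR hε)
      obtain ⟨l', hl'⟩ := exists_startsAt_of_mem_ER (hXR hε')
      -- The two expansions may start at different indices; the smaller serves both.
      have m : StartsAt (min l l') ε := fun i hi => hl i (by omega)
      have m' : StartsAt (min l l') ε' := fun i hi => hl' i (by omega)
      exact ⟨min l l', ε, hε, ε', hε', hne, m, m', (rec_iff _ ε ε' hε hε' m m').1 heq.symm, rfl⟩
    · rintro ⟨l, ε, hε, ε', hε', hne, hl, hl', hrec, rfl⟩
      exact ⟨ε, hε, ε', hε', hne, rfl, ((rec_iff l ε ε' hε hε' hl hl').2 hrec).symm⟩
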